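/- Let $\ell[y]=-((1-x^2)y')'$ be the Legendre expression on $(-1,1)$, let $n\ge 1$, and let $\ell^n$ be its $n$-fold composition, with Lagrangian symmetric form $\ell^n[y]=\sum_{j=1}^n(-1)^j\bigl(a_j y^{(j)}\bigr)^{(j)}$; here $a_j(x)={n\brace j}(1-x^2)^j$, where the ${n\brace j}$ are the Legendre--Stirling numbers of the second kind (${0\brace 0}=1$, ${n\brace 0}={0\brace n}=0$ for $n\ge1$, ${n\brace j}={n-1\brace j-1}+j(j+1){n-1\brace j}$). Let $$\mathcal D^n_{\max}=\{f:(-1,1)\to\mathbb C \mid f,f',\dots,f^{(2n-1)}\in AC_{loc}(-1,1),\ f,\ell^n[f]\in L^2(-1,1)\}.$$ For $f\in\mathcal D^n_{\max}$ and a polynomial $g$ put $[f,g]_n\big|_\alpha^\beta=\int_\alpha^\beta\{\ell^n[f]\,\overline g-\ell^n[\overline g]\,f\}\,dx$ and $[f,g]_n\big|_{-1}^{1}=\lim_{\alpha\to-1^+,\,\beta\to1^-}[f,g]_n\big|_\alpha^\beta$. For a function $u$ on $(-1,1)$, $u\big|_{-1}^{1}=0$ means that the finite limits $\lim_{x\to1^-}u(x)$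 and $\lim_{x\to-1^+}u(x)$ exist and are equal. With $P_0,P_1,P_2,\dots$ the Legendre polynomials, define $$\mathcal B_n=\{f\in\mathcal D^n_{\max} : [f,P_j]_n\big|_{-1}^1=0 \text{ for } j=0,\dots,n-1\},$$ $$\mathcal C_n=\{f\in\mathcal D^n_{\max} : \text{for every set } S \text{ of } n \text{ distinct indices } j\ge 0,\ [f,P_j]_n\big|_{-1}^1=0\text{ for all } j\in S\},$$ $$\mathcal F_n=\{f\in\mathcal D^n_{\max} : (a_j f^{(j)})^{(j-1)}\big|_{-1}^1=0 \text{ for } j=1,\dots,n\}.$$ **Theorem.** Let $n\ge1$. Every $f\in\mathcal F_n$ such that $f'',f''',\dots,f^{(2n-2)}\in L^2(-1,1)$ and, in the case $n=1$ (where this list is empty), such that moreover $\lim_{x\to1^-}(1-x^2)f'(x)=0$ (so that this limit vanishes at both endpoints), belongs to $\mathcal C_n$; that is, $[f,P_s]_n\big|_{-1}^1=0$ for all $s\ge0$. Furthermore $\mathcal C_n\subseteq\mathcal B_n$. In particular, for $n\ge2$, if all $f\in\mathcal F_n$ satisfy $f'',\dots,f^{(2n-2)}\in L^2(-1,1)$,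 then $\mathcal F_n\subseteq\mathcal C_n\subseteq\mathcal B_n$. -/

import Mathlib

open Filter Topology MeasureTheory Set

namespace LegendrePowers

/-- The Legendre expression `ℓ[y](x) = -((1 - x²) y'(x))'`, for complex valued functions.
Functions on `(-1, 1)` are represented by functions on `ℝ`; everything below depends only on the
restriction to `(-1, 1)`. -/
noncomputable def ell (y : ℝ → ℂ) : ℝ → ℂ :=
  fun x => -deriv (fun t : ℝ => (1 - (t : ℂ) ^ 2) * deriv y t) x

/-- The `n`-fold composition `ℓⁿ` of the Legendre expression with itself. -/
noncomputable def ellPow (n : ℕ) (y : ℝ → ℂ) : ℝ → ℂ := ell^[n] y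

/-- Lebesgue measure on `(-1, 1)`. -/
noncomputable def vol : Measure ℝ := volume.restrict (Ioo (-1 : ℝ) 1)

/-- Local absolute continuity on `(-1, 1)`: absolute continuity on every compact subinterval. -/
def ACloc (y : ℝ → ℂ) : Prop :=
  ∀ α β : ℝ, -1 < α → α ≤ β → β < 1 → AbsolutelyContinuousOnInterval y α β

/-- The maximal domain of `ℓⁿ` in `L²(-1, 1)`. -/
def maxDomain (n : ℕ) : Set (ℝ → ℂ) :=
  {f | (∀ k : ℕ, k + 1 ≤ 2 * n → ACloc (iteratedDeriv k f)) ∧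
    MemLp f 2 vol ∧ MemLp (ellPow n f) 2 vol}

/-- The sesquilinear form of `ℓⁿ` between `α` and `β`, given by Green's formula. -/
noncomputable def form (n : ℕ) (f g : ℝ → ℂ) (α β : ℝ) : ℂ :=
  ∫ x in α..β, (ellPow n f x * star (g x) - ellPow n (fun t => star (g t)) x * f x)

/-- `[f, g]ₙ |_{-1}^{1} = 0`, as a limit of the form over `[α, β]` as `α → -1⁺` and `β → 1⁻`. -/
def FormVanishes (n : ℕ) (f g : ℝ → ℂ) : Prop :=
  Tendsto (fun p : ℝ × ℝ => form n f g p.1 p.2) (𝓝[>] (-1) ×ˢ 𝓝[<] 1) (𝓝 0)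

/-- The Legendre polynomial `P_k = (2^k k!)⁻¹ (d/dx)^k (x² - 1)^k`. -/
noncomputable def legendrePoly (k : ℕ) : Polynomial ℝ :=
  Polynomial.C ((2 ^ k * (k.factorial : ℝ))⁻¹) *
    Polynomial.derivative^[k] ((Polynomial.X ^ 2 - 1) ^ k)

/-- The Legendre polynomial `P_k` as a complex valued function of a real variable. -/
noncomputable def P (k : ℕ) : ℝ → ℂ := fun x => (((legendrePoly k).eval x : ℝ) : ℂ)

/-- The Legendre–Stirling numbers of the second kind. -/
def legendreStirling : ℕ → ℕ → ℕ
  | 0, 0 => 1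
  | 0, _ + 1 => 0
  | _ + 1, 0 => 0
  | n + 1, j + 1 => legendreStirling n j + (j + 1) * (j + 2) * legendreStirling n (j + 1)

/-- The coefficients `a_j` in the Lagrangian symmetric form
`ℓⁿ[f] = ∑_{j=1}^n (-1)^j (a_j f^{(j)})^{(j)}`. -/
noncomputable def coeff (n j : ℕ) (x : ℝ) : ℂ :=
  (legendreStirling n j : ℂ) * (1 - (x : ℂ) ^ 2) ^ j

/-- `u |_{-1}^{1} = 0`: the one-sided limits of `u` at `-1` and at `1` exist (finitely) and
agree. -/
def BoundaryDiffZero (u : ℝ → ℂ) : Prop :=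
  ∃ L : ℂ, Tendsto u (𝓝[>] (-1)) (𝓝 L) ∧ Tendsto u (𝓝[<] 1) (𝓝 L)

/-- `ℬₙ`: the conditions `[f, P_j]ₙ |_{-1}^{1} = 0` for `j = 0, …, n - 1`. -/
def domB (n : ℕ) : Set (ℝ → ℂ) :=
  {f | f ∈ maxDomain n ∧ ∀ j : ℕ, j < n → FormVanishes n f (P j)}

/-- `𝒞ₙ`: the conditions `[f, P_j]ₙ |_{-1}^{1} = 0` for any `n` distinct indices `j`. -/
def domC (n : ℕ) : Set (ℝ → ℂ) :=
  {f | f ∈ maxDomain n ∧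
    ∀ S : Finset ℕ, S.card = n → ∀ j ∈ S, FormVanishes n f (P j)}

/-- `ℱₙ`: the conditions `(a_j f^{(j)})^{(j-1)} |_{-1}^{1} = 0` for `j = 1, …, n`. -/
def domF (n : ℕ) : Set (ℝ → ℂ) :=
  {f | f ∈ maxDomain n ∧ ∀ j : ℕ, 1 ≤ j → j ≤ n →
    BoundaryDiffZero (iteratedDeriv (j - 1) (fun x => coeff n j x * iteratedDeriv j f x))}

/-- The functions `f` with `f'', …, f^{(2n-2)} ∈ L²(-1, 1)` (no condition when `n = 1`). -/
def derivsInL2 (n : ℕ) : Set (ℝ → ℂ) :=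
  {f | ∀ k : ℕ, 2 ≤ k → k + 2 ≤ 2 * n → MemLp (iteratedDeriv k f) 2 vol}

end LegendrePowers

open scoped ContDiff

/-! Green's formula for `ℓ` alone, applied repeatedly, moves the `n` factors of `ℓⁿ` from `f` to a
smooth `g`. It writes the form of `ℓⁿ` as the boundary values of the brackets of `ℓᵏ f` with `ℓⁿ⁻¹⁻ᵏ
g`, for `k < n` (`tendsto_form_of_brackets`). Such a bracket is `(1 - x²)(h g' - h' g)` with `h = ℓᵏ
f`. It vanishes at the endpoints once `(1 - x²) h'` does, because `(1 - x²) h` then tends to zero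
too (`tendsto_bracket`). So it suffices that `(1 - x²)(ℓᵏ f)' → 0` for every `k < n`.

For `n ≥ 2`, `f^{(2n-2)}` is integrable, so all derivatives of lower order are bounded. If `k ≤ n -
2`, then `(ℓᵏ f)'` involves orders at most `2n - 3` and is bounded. The last iterate `h = ℓⁿ⁻¹ f`
needs another argument (`tendsto_weight_mul_deriv_ell`). Since `ℓ h = ℓⁿ f` is integrable, `(1 - x²)
h'` has limits at the endpoints, and a nonzero limit would make `h` grow logarithmically. With `y =
ℓⁿ⁻² f`, however, `h = -(1 - x²) y'' + 2x y'`, where `y'` is bounded and `y''` integrable. Growth of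
`h` would force `|y''| ≥ 1/(1 - |x|)` near the endpoint, which is not integrable.

For `n = 1`, membership in `ℱ₁` makes the two limits of `(1 - x²) f'` equal, and the extra
hypothesis makes them zero. -/

namespace LegendrePowers

/-! ### Absolutely continuous complex valued functions -/

/-- The fundamental theorem of calculus for complex valued absolutely continuous functions. -/
theorem integral_deriv_of_absolutelyContinuous {F : ℝ → ℂ} {a b : ℝ}
    (hF : AbsolutelyContinuousOnInterval F a b) :
    IntervalIntegrable (deriv F) volume a b ∧ ∫ x in a..b, deriv F x = F b - F a := by
  -- A real functional that does not increase norms preserves absolute continuity; real and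
  -- imaginary parts reduce the claim to the real-valued theorem.
  have comp : ∀ φ : ℂ →L[ℝ] ℝ, (∀ z, |φ z| ≤ ‖z‖) →
      AbsolutelyContinuousOnInterval (fun x => φ (F x)) a b := by
    intro φ hφ
    refine squeeze_zero (fun t => Finset.sum_nonneg fun i _ => dist_nonneg) (fun t => ?_) hF
    refine Finset.sum_le_sum fun i _ => ?_
    rw [Real.dist_eq, dist_eq_norm, ← map_sub]
    exact hφ _
  have hre := comp Complex.reCLM Complex.abs_re_le_norm
  have him := comp Complex.imCLM Complex.abs_im_le_norm
  have hae : ∀ᵐ x, x ∈ uIoc a b → HasDerivAt F (deriv F x) x := by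
    filter_upwards [hF.boundedVariationOn.ae_differentiableAt_of_mem_uIcc] with x hx hx'
    exact (hx (uIoc_subset_uIcc hx')).hasDerivAt
  have hdre : ∀ᵐ x, x ∈ uIoc a b →
      deriv (fun x => Complex.reCLM (F x)) x = (deriv F x).re := by
    filter_upwards [hae] with x hx hx'
    exact (Complex.reCLM.hasFDerivAt.comp_hasDerivAt x (hx hx')).deriv
  have hdim : ∀ᵐ x, x ∈ uIoc a b →
      deriv (fun x => Complex.imCLM (F x)) x = (deriv F x).im := by
    filter_upwards [hae] with x hx hx'
    exact (Complex.imCLM.hasFDerivAt.comp_hasDerivAt x (hx hx')).deriv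
  have ire : IntervalIntegrable (fun x => (deriv F x).re) volume a b :=
    hre.intervalIntegrable_deriv.congr_ae ((ae_restrict_iff' measurableSet_uIoc).2 hdre)
  have iim : IntervalIntegrable (fun x => (deriv F x).im) volume a b :=
    him.intervalIntegrable_deriv.congr_ae ((ae_restrict_iff' measurableSet_uIoc).2 hdim)
  have hint : IntervalIntegrable (deriv F) volume a b := by
    rw [intervalIntegrable_iff] at ire iim ⊢
    have := ire.ofReal (𝕜 := ℂ) |>.add (iim.ofReal (𝕜 := ℂ) |>.mul_const Complex.I)
    refine this.congr (Eventually.of_forall fun x => ?_)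
    simp [Complex.re_add_im]
  refine ⟨hint, ?_⟩
  have e1 := hre.integral_deriv_eq_sub
  have e2 := him.integral_deriv_eq_sub
  rw [intervalIntegral.integral_congr_ae hdre] at e1
  rw [intervalIntegral.integral_congr_ae hdim] at e2
  apply Complex.ext
  · have := Complex.reCLM.intervalIntegral_comp_comm hint
    simp only [Complex.reCLM_apply] at this e1
    rw [← this, e1, Complex.sub_re]
  · have := Complex.imCLM.intervalIntegral_comp_comm hint
    simp only [Complex.imCLM_apply] at this e2
    rw [← this, e2, Complex.sub_im]

theorem uIcc_zero_subset_Ioo {x : ℝ} (hx : x ∈ Ioo (-1 : ℝ) 1) :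
    uIcc 0 x ⊆ Ioo (-1 : ℝ) 1 :=
  (convex_Ioo (-1 : ℝ) 1).ordConnected.uIcc_subset (by norm_num) hx

theorem ACloc.absolutelyContinuous_zero {F : ℝ → ℂ} (hF : ACloc F) {x : ℝ}
    (hx : x ∈ Ioo (-1 : ℝ) 1) : AbsolutelyContinuousOnInterval F 0 x := by
  rcases le_total 0 x with h | h
  · exact hF 0 x (by norm_num) h hx.2
  · exact (hF x 0 hx.1 h (by norm_num)).symm

theorem ACloc.continuousOn {F : ℝ → ℂ} (hF : ACloc F) : ContinuousOn F (Ioo (-1) 1) := by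
  intro x hx
  have hc := (hF ((x - 1) / 2) ((x + 1) / 2) (by linarith [hx.1]) (by linarith)
    (by linarith [hx.2])).continuousOn
  rw [uIcc_of_le (by linarith)] at hc
  exact (hc.continuousAt (Icc_mem_nhds (by linarith [hx.1, hx.2])
    (by linarith [hx.1, hx.2]))).continuousWithinAt

theorem ACloc.eq_integral {F : ℝ → ℂ} (hF : ACloc F) {x : ℝ} (hx : x ∈ Ioo (-1 : ℝ) 1) :
    F x = F 0 + ∫ t in (0 : ℝ)..x, deriv F t := by
  rw [(integral_deriv_of_absolutelyContinuous (hF.absolutelyContinuous_zero hx)).2]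
  ring

/-- A locally absolutely continuous function with integrable derivative extends continuously. -/
theorem ACloc.exists_continuous_eqOn {F : ℝ → ℂ} (hF : ACloc F)
    (hi : IntegrableOn (deriv F) (Ioo (-1) 1)) :
    ∃ G : ℝ → ℂ, Continuous G ∧ EqOn F G (Ioo (-1) 1) := by
  refine ⟨fun x => F 0 + ∫ t in (0 : ℝ)..x, (Ioo (-1 : ℝ) 1).indicator (deriv F) t, ?_, ?_⟩
  · refine continuous_const.add (intervalIntegral.continuous_primitive (fun a b => ?_) 0)
    exact ((integrable_indicator_iff measurableSet_Ioo).2 hi).intervalIntegrable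
  · intro x hx
    simp only
    rw [hF.eq_integral hx]
    congr 1
    refine intervalIntegral.integral_congr fun t ht => ?_
    rw [indicator_of_mem (uIcc_zero_subset_Ioo hx ht)]

/-- Absolute continuity gives differentiability only almost everywhere, and `deriv` is zero
elsewhere. When `deriv F` is continuous, `F` is the integral of a continuous function and hence
differentiable everywhere. -/
theorem ACloc.differentiableOn {F : ℝ → ℂ} (hF : ACloc F)
    (hc : ContinuousOn (deriv F) (Ioo (-1) 1)) :
    ∀ x ∈ Ioo (-1 : ℝ) 1, DifferentiableAt ℝ F x := by
  intro x hx
  have hd : HasDerivAt (fun u => F 0 + ∫ t in (0 : ℝ)..u, deriv F t) (deriv F x) x := by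
    refine (intervalIntegral.integral_hasDerivAt_right ?_ ?_ ?_).const_add _
    · exact (hc.mono (uIcc_zero_subset_Ioo hx)).intervalIntegrable
    · exact hc.stronglyMeasurableAtFilter isOpen_Ioo x hx
    · exact hc.continuousAt (isOpen_Ioo.mem_nhds hx)
  refine (hd.congr_of_eventuallyEq ?_).differentiableAt
  filter_upwards [isOpen_Ioo.mem_nhds hx] with u hu using hF.eq_integral hu

theorem absolutelyContinuous_of_contDiff {g : ℝ → ℂ} (hg : ContDiff ℝ 1 g) (a b : ℝ) :
    AbsolutelyContinuousOnInterval g a b :=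
  hg.contDiffOn.absolutelyContinuousOnInterval

/-! ### Classes of functions on `(-1, 1)` closed under smooth multipliers -/

/-- A class of functions on `(-1, 1)` which is a module over the smooth functions. -/
structure IsSmoothModule (B : (ℝ → ℂ) → Prop) : Prop where
  congr : ∀ {u v : ℝ → ℂ}, EqOn u v (Ioo (-1) 1) → B u → B v
  add : ∀ {u v : ℝ → ℂ}, B u → B v → B (fun x => u x + v x)
  mul : ∀ {g u : ℝ → ℂ}, ContDiff ℝ ∞ g → B u → B (fun x => g x * u x)

/-- `Tower B T m u`: the derivatives of `u` of order less than `m` exist and satisfy `B`, and the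
`m`-th derivative satisfies `T`. -/
def Tower (B T : (ℝ → ℂ) → Prop) : ℕ → (ℝ → ℂ) → Prop
  | 0, u => T u
  | m + 1, u => B u ∧ (∀ x ∈ Ioo (-1 : ℝ) 1, DifferentiableAt ℝ u x) ∧ Tower B T m (deriv u)

section Tower

variable {B T : (ℝ → ℂ) → Prop} {m : ℕ} {u v : ℝ → ℂ}

theorem Tower.top (hBT : ∀ u, B u → T u) (h : Tower B T m u) : T u := by
  cases m with
  | zero => exact h
  | succ m => exact hBT u h.1

theorem Tower.of_succ (hBT : ∀ u, B u → T u) : ∀ {m : ℕ} {u : ℝ → ℂ},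
    Tower B T (m + 1) u → Tower B T m u
  | 0, _, h => hBT _ h.1
  | _ + 1, _, h => ⟨h.1, h.2.1, Tower.of_succ hBT h.2.2⟩

theorem Tower.mono (hBT : ∀ u, B u → T u) {k m : ℕ} (hkm : k ≤ m) (h : Tower B T m u) :
    Tower B T k u := by
  induction m, hkm using Nat.le_induction with
  | base => exact h
  | succ m _ ih => exact ih (Tower.of_succ hBT h)

/-- By `(g u)' = g' u + g u'`, the induction needs `u` itself one level lower in the tower, which is
where `B → T` enters. -/
theorem isSmoothModule_tower (hB : IsSmoothModule B) (hT : IsSmoothModule T)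
    (hBT : ∀ u, B u → T u) (m : ℕ) : IsSmoothModule (Tower B T m) := by
  induction m with
  | zero => exact hT
  | succ m ih =>
    refine ⟨fun {u v} e h => ⟨hB.congr e h.1, fun x hx => ?_, ?_⟩,
      fun {u v} h h' => ⟨hB.add h.1 h'.1, fun x hx => ?_, ?_⟩,
      fun {g u} hg h => ⟨hB.mul hg h.1, fun x hx => ?_, ?_⟩⟩
    · exact (h.2.1 x hx).congr_of_eventuallyEq
        (e.symm.eventuallyEq_of_mem (isOpen_Ioo.mem_nhds hx))
    · refine ih.congr (fun x hx => ?_) h.2.2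
      exact (e.eventuallyEq_of_mem (isOpen_Ioo.mem_nhds hx)).deriv_eq
    · exact (h.2.1 x hx).fun_add (h'.2.1 x hx)
    · refine ih.congr (fun x hx => ?_) (ih.add h.2.2 h'.2.2)
      exact (deriv_fun_add (h.2.1 x hx) (h'.2.1 x hx)).symm
    · exact ((hg.differentiable (by simp)) x).fun_mul (h.2.1 x hx)
    · have hg' : ContDiff ℝ ∞ (deriv g) := hg.deriv'
      refine ih.congr (fun x hx => ?_)
        (ih.add (ih.mul hg' (Tower.of_succ hBT h)) (ih.mul hg h.2.2))
      exact (deriv_fun_mul ((hg.differentiable (by simp)) x) (h.2.1 x hx)).symm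

theorem contDiff_weight : ContDiff ℝ ∞ (fun t : ℝ => 1 - (t : ℂ) ^ 2) :=
  contDiff_const.sub (Complex.ofRealCLM.contDiff.pow 2)

theorem Tower.ell (hB : IsSmoothModule B) (hT : IsSmoothModule T) (hBT : ∀ u, B u → T u)
    (h : Tower B T (m + 2) u) : Tower B T m (ell u) := by
  have h1 := (isSmoothModule_tower hB hT hBT (m + 1)).mul contDiff_weight h.2.2
  have h2 := (isSmoothModule_tower hB hT hBT m).mul (contDiff_const (c := (-1 : ℂ))) h1.2.2
  refine (isSmoothModule_tower hB hT hBT m).congr (fun x _ => ?_) h2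
  simp [LegendrePowers.ell]

theorem Tower.ell_iterate (hB : IsSmoothModule B) (hT : IsSmoothModule T)
    (hBT : ∀ u, B u → T u) (k : ℕ) (h : Tower B T (m + 2 * k) u) :
    Tower B T m (LegendrePowers.ell^[k] u) := by
  induction k generalizing u with
  | zero => exact h
  | succ k ih =>
    rw [Function.iterate_succ_apply]
    exact ih (Tower.ell hB hT hBT (by rwa [mul_add, mul_one, ← add_assoc] at h))

end Tower

theorem isSmoothModule_ACloc : IsSmoothModule ACloc where
  congr {u v} e h α β hα hαβ hβ := by
    have := h α β hα hαβ hβ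
    rw [absolutelyContinuousOnInterval_iff] at this ⊢
    intro ε hε
    obtain ⟨δ, hδ, H⟩ := this ε hε
    refine ⟨δ, hδ, fun E hE hE' => ?_⟩
    convert H E hE hE' using 2 with i hi
    have hm := hE.1 i (by simpa using hi)
    rw [uIcc_of_le hαβ] at hm
    rw [e ⟨hα.trans_le hm.1.1, hm.1.2.trans_lt hβ⟩, e ⟨hα.trans_le hm.2.1, hm.2.2.trans_lt hβ⟩]
  add h h' α β hα hαβ hβ := (h α β hα hαβ hβ).fun_add (h' α β hα hαβ hβ)
  mul hg h α β hα hαβ hβ :=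
    (absolutelyContinuous_of_contDiff (hg.of_le (by simp)) α β).fun_smul (h α β hα hαβ hβ)

theorem tower_ACloc_of_iteratedDeriv {f : ℝ → ℂ} {M : ℕ}
    (hf : ∀ k ≤ M, ACloc (iteratedDeriv k f)) (m : ℕ) (hm : m ≤ M) :
    Tower ACloc ACloc m (iteratedDeriv (M - m) f) := by
  induction m with
  | zero => exact hf _ (by omega)
  | succ m ih =>
    have e : deriv (iteratedDeriv (M - (m + 1)) f) = iteratedDeriv (M - m) f := by
      rw [← iteratedDeriv_succ]; congr 1; omega
    refine ⟨hf _ (by omega), (hf _ (by omega)).differentiableOn ?_, ?_⟩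
    · rw [e]; exact (hf _ (by omega)).continuousOn
    · rw [e]; exact ih (by omega)

/-- Continuous and bounded on `(-1, 1)`. -/
def ContBdd (u : ℝ → ℂ) : Prop :=
  ContinuousOn u (Ioo (-1) 1) ∧ ∃ C : ℝ, ∀ x ∈ Ioo (-1 : ℝ) 1, ‖u x‖ ≤ C

/-- Integrable on `(-1, 1)`. -/
def Intble (u : ℝ → ℂ) : Prop := IntegrableOn u (Ioo (-1) 1)

theorem exists_norm_le_of_continuous {g : ℝ → ℂ} (hg : Continuous g) :
    ∃ C : ℝ, ∀ x ∈ Ioo (-1 : ℝ) 1, ‖g x‖ ≤ C := by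
  obtain ⟨C, hC⟩ := isCompact_Icc.exists_bound_of_continuousOn
    (s := Icc (-1 : ℝ) 1) hg.continuousOn
  exact ⟨C, fun x hx => hC x (Ioo_subset_Icc_self hx)⟩

theorem ContBdd.intble {u : ℝ → ℂ} (h : ContBdd u) : Intble u := by
  obtain ⟨hc, C, hC⟩ := h
  exact IntegrableOn.of_bound (by simp) (hc.aestronglyMeasurable measurableSet_Ioo) C
    ((ae_restrict_iff' measurableSet_Ioo).2 (Eventually.of_forall hC))

theorem isSmoothModule_contBdd : IsSmoothModule ContBdd where
  congr {u v} e h := ⟨h.1.congr e.symm, h.2.imp fun C hC x hx => by rw [← e hx]; exact hC x hx⟩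
  add {u v} := by
    rintro ⟨hc, C, hC⟩ ⟨hc', C', hC'⟩
    exact ⟨hc.add hc', C + C', fun x hx =>
      (norm_add_le _ _).trans (add_le_add (hC x hx) (hC' x hx))⟩
  mul {g u} hg := by
    rintro ⟨hc, C, hC⟩
    obtain ⟨D, hD⟩ := exists_norm_le_of_continuous hg.continuous
    refine ⟨hg.continuous.continuousOn.mul hc, D * C, fun x hx => ?_⟩
    rw [norm_mul]
    exact mul_le_mul (hD x hx) (hC x hx) (norm_nonneg _) ((norm_nonneg _).trans (hD x hx))

theorem isSmoothModule_intble : IsSmoothModule Intble where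
  congr e h := IntegrableOn.congr_fun h e measurableSet_Ioo
  add h h' := Integrable.add h h'
  mul {g u} hg h := by
    obtain ⟨D, hD⟩ := exists_norm_le_of_continuous hg.continuous
    exact Integrable.bdd_mul h hg.continuous.aestronglyMeasurable
      ((ae_restrict_iff' measurableSet_Ioo).2 (Eventually.of_forall hD))

/-- Descending induction on the order: an integrable derivative bounds the function below it, and a
bounded function on `(-1, 1)` is again integrable. -/
theorem tower_contBdd_of_iteratedDeriv {f : ℝ → ℂ} {M : ℕ}
    (hf : ∀ k ≤ M, ACloc (iteratedDeriv k f)) (hi : Intble (iteratedDeriv M f))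
    (m : ℕ) (hm : m ≤ M) : Tower ContBdd Intble m (iteratedDeriv (M - m) f) := by
  induction m with
  | zero => exact hi
  | succ m ih =>
    have e : deriv (iteratedDeriv (M - (m + 1)) f) = iteratedDeriv (M - m) f := by
      rw [← iteratedDeriv_succ]; congr 1; omega
    have hac := hf (M - (m + 1)) (by omega)
    have ht := ih (by omega)
    rw [← e] at ht
    refine ⟨?_, hac.differentiableOn ?_, ht⟩
    · obtain ⟨G, hG, hFG⟩ := hac.exists_continuous_eqOn (ht.top fun _ => ContBdd.intble)
      exact isSmoothModule_contBdd.congr hFG.symm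
        ⟨hG.continuousOn, exists_norm_le_of_continuous hG⟩
    · rw [e]; exact (hf _ (by omega)).continuousOn

/-! ### Green's formula -/

theorem contDiff_ell {g : ℝ → ℂ} (hg : ContDiff ℝ ∞ g) : ContDiff ℝ ∞ (ell g) :=
  (contDiff_weight.mul hg.deriv').deriv'.neg

/-- Lagrange's bracket of the Legendre expression. -/
noncomputable def bracket (h g : ℝ → ℂ) (x : ℝ) : ℂ :=
  h x * ((1 - (x : ℂ) ^ 2) * deriv g x) - (1 - (x : ℂ) ^ 2) * deriv h x * g x

/-- As `(1 - x²) h'` is only absolutely continuous, the bracket is differentiated almost everywhere;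
being absolutely continuous itself, it is still recovered by integration. -/
theorem integral_ell_green {h g : ℝ → ℂ} (hh : Tower ACloc ACloc 1 h) (hg : ContDiff ℝ ∞ g)
    {α β : ℝ} (hα : -1 < α) (hαβ : α ≤ β) (hβ : β < 1) :
    IntervalIntegrable (fun x => ell h x * g x - ell g x * h x) volume α β ∧
    ∫ x in α..β, (ell h x * g x - ell g x * h x) = bracket h g β - bracket h g α := by
  have hF : AbsolutelyContinuousOnInterval (fun x => (1 - (x : ℂ) ^ 2) * deriv h x) α β :=
    isSmoothModule_ACloc.mul contDiff_weight hh.2.2 α β hα hαβ hβ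
  have hpg : ContDiff ℝ ∞ (fun x : ℝ => (1 - (x : ℂ) ^ 2) * deriv g x) :=
    contDiff_weight.mul hg.deriv'
  have hW : AbsolutelyContinuousOnInterval (bracket h g) α β :=
    ((hh.1 α β hα hαβ hβ).fun_smul
      (absolutelyContinuous_of_contDiff (hpg.of_le (by simp)) α β)).fun_sub
      (hF.fun_smul (absolutelyContinuous_of_contDiff (hg.of_le (by simp)) α β))
  obtain ⟨hi, he⟩ := integral_deriv_of_absolutelyContinuous hW
  have hae : ∀ᵐ x, x ∈ uIoc α β →
      deriv (bracket h g) x = ell h x * g x - ell g x * h x := by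
    filter_upwards [hF.boundedVariationOn.ae_differentiableAt_of_mem_uIcc] with x hx hx'
    have hx1 := uIoc_subset_uIcc hx'
    have hx2 : x ∈ Ioo (-1 : ℝ) 1 := by
      rw [uIcc_of_le hαβ] at hx1
      exact ⟨hα.trans_le hx1.1, hx1.2.trans_lt hβ⟩
    have d1 := (hh.2.1 x hx2).hasDerivAt
    have d2 := (hx hx1).hasDerivAt
    have d3 := ((hpg.differentiable (by simp)) x).hasDerivAt
    have d4 := ((hg.differentiable (by simp)) x).hasDerivAt
    refine ((d1.mul d3).sub (d2.mul d4)).deriv.trans ?_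
    simp only [ell]
    ring
  exact ⟨hi.congr_ae ((ae_restrict_iff' measurableSet_uIoc).2 hae),
    by rw [← he, intervalIntegral.integral_congr_ae hae]⟩

/-- If the brackets of `f, ℓ[f], …, ℓⁿ⁻¹[f]` with smooth functions vanish at the endpoints, then
so does the form of `ℓⁿ`. -/
theorem tendsto_form_of_brackets {f : ℝ → ℂ} {n : ℕ}
    (hf : ∀ k < n, Tower ACloc ACloc 1 (ell^[k] f))
    (hb : ∀ k < n, ∀ g : ℝ → ℂ, ContDiff ℝ ∞ g →
      Tendsto (bracket (ell^[k] f) g) (𝓝[>] (-1)) (𝓝 0) ∧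
      Tendsto (bracket (ell^[k] f) g) (𝓝[<] 1) (𝓝 0)) (g : ℝ → ℂ) (hg : ContDiff ℝ ∞ g) :
    (∀ α β : ℝ, -1 < α → α ≤ β → β < 1 →
      IntervalIntegrable (fun x => ell^[n] f x * g x - ell^[n] g x * f x) volume α β) ∧
    Tendsto (fun p : ℝ × ℝ => ∫ x in p.1..p.2, (ell^[n] f x * g x - ell^[n] g x * f x))
      (𝓝[>] (-1) ×ˢ 𝓝[<] 1) (𝓝 0) := by
  induction n generalizing g with
  | zero => simp [mul_comm (f _)]
  | succ n ih =>
    obtain ⟨i1, t1⟩ := ih (fun k hk => hf k (by omega)) (fun k hk => hb k (by omega))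
      (ell g) (contDiff_ell hg)
    have hgreen := fun α β hα hαβ hβ =>
      integral_ell_green (hf n (by omega)) hg (α := α) (β := β) hα hαβ hβ
    -- Insert the mixed term `ℓⁿ f · ℓ g`: one summand is Green's formula for `ℓ`, the other is the
    -- induction hypothesis with `ℓ g` in place of `g`.
    have e : (fun x => ell^[n + 1] f x * g x - ell^[n + 1] g x * f x) = fun x =>
        (ell (ell^[n] f) x * g x - ell g x * ell^[n] f x) +
        (ell^[n] f x * ell g x - ell^[n] (ell g) x * f x) := by
      funext x
      rw [Function.iterate_succ_apply', Function.iterate_succ_apply]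
      ring
    rw [e]
    refine ⟨fun α β hα hαβ hβ => (hgreen α β hα hαβ hβ).1.add (i1 α β hα hαβ hβ), ?_⟩
    obtain ⟨b1, b2⟩ := hb n (by omega) g hg
    have hlim := ((b2.comp tendsto_snd).sub (b1.comp tendsto_fst)).add t1
    rw [sub_zero, add_zero] at hlim
    refine hlim.congr' ?_
    have hev : ∀ᶠ p : ℝ × ℝ in 𝓝[>] (-1) ×ˢ 𝓝[<] 1,
        p.1 ∈ Ioo (-1 : ℝ) 0 ∧ p.2 ∈ Ioo (0 : ℝ) 1 :=
      prod_mem_prod (Ioo_mem_nhdsGT (by norm_num)) (Ioo_mem_nhdsLT (by norm_num))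
    filter_upwards [hev] with p hp
    obtain ⟨j1, j2⟩ := hgreen p.1 p.2 hp.1.1 (hp.1.2.trans hp.2.1).le hp.2.2
    rw [intervalIntegral.integral_add j1 (i1 p.1 p.2 hp.1.1 (hp.1.2.trans hp.2.1).le hp.2.2), j2]
    rfl

/-! ### Behaviour at the endpoints -/

theorem exists_Ioo_of_eventually_nhdsLT_one {p : ℝ → Prop} (h : ∀ᶠ x : ℝ in 𝓝[<] 1, p x) :
    ∃ a ∈ Ioo (0 : ℝ) 1, ∀ x ∈ Ioo a 1, p x := by
  obtain ⟨l, hl, hl'⟩ := (mem_nhdsLT_iff_exists_Ioo_subset' (show (0 : ℝ) < 1 by norm_num)).1 h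
  refine ⟨max l (1 / 2), ⟨by positivity, max_lt hl (by norm_num)⟩, fun x hx => hl' ⟨?_, hx.2⟩⟩
  exact (le_max_left _ _).trans_lt hx.1

theorem norm_weight {x : ℝ} (hx : x ∈ Ioo (0 : ℝ) 1) : ‖1 - (x : ℂ) ^ 2‖ = 1 - x ^ 2 := by
  have : (1 - (x : ℂ) ^ 2) = ((1 - x ^ 2 : ℝ) : ℂ) := by push_cast; rfl
  rw [this, Complex.norm_real, Real.norm_of_nonneg (by nlinarith [hx.1, hx.2])]

/-- If `(1 - x²) h'` vanishes at `1`, then so does `(1 - x²) h`. -/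
theorem tendsto_weight_mul_of_deriv {h h' : ℝ → ℂ}
    (hd : ∀ x ∈ Ioo (-1 : ℝ) 1, HasDerivAt h (h' x) x)
    (hp : Tendsto (fun x : ℝ => (1 - (x : ℂ) ^ 2) * h' x) (𝓝[<] 1) (𝓝 0)) :
    Tendsto (fun x : ℝ => (1 - (x : ℂ) ^ 2) * h x) (𝓝[<] 1) (𝓝 0) := by
  rw [Metric.tendsto_nhds]
  intro ε hε
  have h1 : ∀ᶠ x : ℝ in 𝓝[<] 1, ‖(1 - (x : ℂ) ^ 2) * h' x‖ < ε / 4 := by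
    simpa [dist_eq_norm] using (Metric.tendsto_nhds.1 hp) (ε / 4) (by positivity)
  obtain ⟨a, ha, ha'⟩ := exists_Ioo_of_eventually_nhdsLT_one h1
  set b := (a + 1) / 2 with hb
  have hb1 : b ∈ Ioo a 1 := ⟨by linarith [ha.2], by linarith [ha.2]⟩
  have h2 : Tendsto (fun x : ℝ => 2 * (1 - x) * ‖h b‖) (𝓝[<] 1) (𝓝 0) := by
    have : Continuous (fun x : ℝ => 2 * (1 - x) * ‖h b‖) := by fun_prop
    simpa using (this.tendsto 1).mono_left nhdsWithin_le_nhds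
  filter_upwards [Ioo_mem_nhdsLT hb1.2,
    h2.eventually (gt_mem_nhds (show (0 : ℝ) < ε / 2 by positivity))] with x hx hx2
  have hx0 : x ∈ Ioo (0 : ℝ) 1 := ⟨by linarith [hx.1, hb1.1, ha.1], hx.2⟩
  -- On `[b, x]`, `‖h'‖` is at most `(ε/4)/(1 - t²)`, hence at most `(ε/4)/(1 - x)`. The factor `1 -
  -- x² ≤ 2 (1 - x)` later turns this into `ε/2`; the term with `h b` takes the other half.
  have hmv : ‖h x - h b‖ ≤ ε / 4 / (1 - x) * (x - b) := by
    refine norm_image_sub_le_of_norm_deriv_le_segment' (f' := h') (a := b) (b := x)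
      (fun t ht => (hd t ⟨by linarith [ht.1, hb1.1, ha.1],
        by linarith [ht.2, hx.2]⟩).hasDerivWithinAt)
      (fun t ht => ?_) x ⟨hx.1.le, le_rfl⟩
    have ht1 : t ∈ Ioo a 1 := ⟨by linarith [ht.1, hb1.1], by linarith [ht.2, hx.2]⟩
    have ht0 : t ∈ Ioo (0 : ℝ) 1 := ⟨by linarith [ht1.1, ha.1], ht1.2⟩
    have := ha' t ht1
    rw [norm_mul, norm_weight ht0] at this
    rw [le_div_iff₀ (by linarith [hx.2])]
    have : 1 - x ≤ 1 - t ^ 2 := by nlinarith [ht0.1, ht0.2, ht.2]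
    nlinarith [norm_nonneg (h' t)]
  rw [dist_zero_right, norm_mul, norm_weight hx0]
  have h3 : ‖h x‖ ≤ ‖h b‖ + ε / 4 / (1 - x) * (x - b) := by
    have := norm_sub_norm_le (h x) (h b)
    linarith
  have hpos : 0 < 1 - x := by linarith [hx.2]
  have h4 : (1 - x) * ‖h x‖ ≤ (1 - x) * ‖h b‖ + ε / 4 * (x - b) := by
    calc (1 - x) * ‖h x‖ ≤ (1 - x) * (‖h b‖ + ε / 4 / (1 - x) * (x - b)) := by gcongr
      _ = _ := by field_simp
  have h5 : ε / 4 * (x - b) ≤ ε / 4 := by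
    have : x - b ≤ 1 := by linarith [hb1.1, ha.1, hx.2]
    nlinarith
  have h6 : (1 - x ^ 2) * ‖h x‖ ≤ 2 * ((1 - x) * ‖h x‖) := by
    nlinarith [mul_nonneg hpos.le (norm_nonneg (h x)),
      mul_nonneg (mul_nonneg hpos.le hpos.le) (norm_nonneg (h x))]
  linarith

theorem not_intble_of_inv_le {v : ℝ → ℂ} {a : ℝ} (ha : a ∈ Ioo (0 : ℝ) 1)
    (h : ∀ x ∈ Ioo a 1, (1 - x)⁻¹ ≤ ‖v x‖) : ¬ Intble v := by
  intro hv
  have h1 : IntegrableOn (fun x : ℝ => (x - 1)⁻¹) (Ioo a 1) := by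
    refine Integrable.mono (IntegrableOn.mono_set hv (Ioo_subset_Ioo_left (by linarith [ha.1])))
      (by fun_prop) ((ae_restrict_iff' measurableSet_Ioo).2 (Eventually.of_forall fun x hx => ?_))
    rw [norm_inv, Real.norm_eq_abs, abs_sub_comm, abs_of_pos (by linarith [hx.2])]
    exact h x hx
  have h2 : IntervalIntegrable (fun x : ℝ => (x - 1)⁻¹) volume a 1 := by
    rwa [intervalIntegrable_iff_integrableOn_Ioo_of_le ha.2.le]
  rw [intervalIntegrable_sub_inv_iff] at h2
  rcases h2 with h2 | h2
  · exact ha.2.ne h2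
  · exact h2 right_mem_uIcc

/-- If `h = (1 - x²) v + r` with `v` integrable and `r` bounded, then a limit of `(1 - x²) h'` at
`1` can only be zero: otherwise `h` would grow logarithmically. -/
theorem eq_zero_of_tendsto_weight_mul_deriv {h h' v r : ℝ → ℂ} {L : ℂ}
    (hd : ∀ x ∈ Ioo (-1 : ℝ) 1, HasDerivAt h (h' x) x)
    (hp : Tendsto (fun x : ℝ => (1 - (x : ℂ) ^ 2) * h' x) (𝓝[<] 1) (𝓝 L))
    (hv : Intble v) {C : ℝ} (hr : ∀ x ∈ Ioo (-1 : ℝ) 1, ‖r x‖ ≤ C)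
    (hh : ∀ x ∈ Ioo (-1 : ℝ) 1, h x = (1 - (x : ℂ) ^ 2) * v x + r x) : L = 0 := by
  by_contra hL
  have hL0 : 0 < ‖L‖ := norm_pos_iff.2 hL
  -- Multiplying by `star L` makes the limit the positive number `‖L‖² = 4c`. Values eventually
  -- exceed `2c`, and dividing by `1 + x < 2` leaves `(1 - x) R (h') ≥ c`.
  set c := ‖L‖ ^ 2 / 4 with hc
  have hc0 : 0 < c := by positivity
  let R : ℂ →L[ℝ] ℝ := Complex.reCLM.comp (ContinuousLinearMap.mul ℝ ℂ (star L))
  have hR : ∀ z, R z ≤ ‖L‖ * ‖z‖ := fun z => by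
    have : R z = (star L * z).re := rfl
    rw [this]
    refine (Complex.re_le_norm _).trans ?_
    rw [norm_mul, norm_star]
  have hRL : R L = ‖L‖ ^ 2 := by
    have : R L = (star L * L).re := rfl
    rw [this, Complex.star_def, mul_comm, Complex.mul_conj, Complex.normSq_eq_norm_sq]
    exact Complex.ofReal_re _
  have h1 : ∀ᶠ x : ℝ in 𝓝[<] 1, 2 * c < R ((1 - (x : ℂ) ^ 2) * h' x) := by
    have := (R.continuous.tendsto L).comp hp
    rw [hRL] at this
    exact this.eventually (lt_mem_nhds (by nlinarith))
  obtain ⟨a, ha, ha'⟩ := exists_Ioo_of_eventually_nhdsLT_one h1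
  have hderiv : ∀ x ∈ Ioo a 1, HasDerivAt (fun x => R (h x) + c * Real.log (1 - x))
      (R (h' x) + c * (-1 / (1 - x))) x := by
    intro x hx
    refine (R.hasFDerivAt.comp_hasDerivAt x (hd x ⟨by linarith [hx.1, ha.1], hx.2⟩)).add
      (HasDerivAt.const_mul c ?_)
    exact ((hasDerivAt_id x).const_sub 1).log (by simpa using by linarith [hx.2])
  have hmono : MonotoneOn (fun x => R (h x) + c * Real.log (1 - x)) (Ioo a 1) := by
    refine monotoneOn_of_deriv_nonneg (convex_Ioo a 1)
      (fun x hx => (hderiv x hx).continuousAt.continuousWithinAt)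
      (fun x hx => (hderiv x (interior_subset hx)).differentiableAt.differentiableWithinAt)
      (fun x hx => ?_)
    replace hx := interior_subset hx
    rw [(hderiv x hx).deriv]
    have h3 := ha' x hx
    have h4 : R ((1 - (x : ℂ) ^ 2) * h' x) = (1 - x ^ 2) * R (h' x) := by
      have : (1 - (x : ℂ) ^ 2) * h' x = (1 - x ^ 2 : ℝ) • h' x := by
        rw [Complex.real_smul]; push_cast; rfl
      rw [this, map_smul, smul_eq_mul]
    rw [h4] at h3
    have hx1 : 0 < 1 - x := by linarith [hx.2]
    have hx2 : 0 < 1 + x := by linarith [hx.1, ha.1]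
    have h5 : c ≤ (1 - x) * R (h' x) := by
      have : 2 * c < (1 + x) * ((1 - x) * R (h' x)) := by linarith
      by_contra hcon
      nlinarith
    have : c / (1 - x) ≤ R (h' x) := by rw [div_le_iff₀ hx1]; linarith
    have : c * (-1 / (1 - x)) = -(c / (1 - x)) := by ring
    linarith
  set b := (a + 1) / 2 with hb
  have hb1 : b ∈ Ioo a 1 := ⟨by linarith [ha.2], by linarith [ha.2]⟩
  have hlog : Tendsto (fun x : ℝ => -(c * Real.log (1 - x))) (𝓝[<] 1) atTop := by
    refine tendsto_neg_atBot_atTop.comp (Tendsto.const_mul_atBot hc0 ?_)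
    refine Real.tendsto_log_nhdsGT_zero.comp (tendsto_nhdsWithin_iff.2 ⟨?_, ?_⟩)
    · have : Continuous (fun x : ℝ => 1 - x) := by fun_prop
      simpa using (this.tendsto 1).mono_left nhdsWithin_le_nhds
    · filter_upwards [self_mem_nhdsWithin] with x hx
      simpa using hx
  -- Once `‖h‖ ≥ C + 2`, the bound on `r` leaves `(1 - x²) ‖v‖ ≥ 2`, and `1 - x² ≤ 2 (1 - x)` gives
  -- `‖v‖ ≥ 1/(1 - x)`.
  obtain ⟨d, hd', hd''⟩ := exists_Ioo_of_eventually_nhdsLT_one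
    ((hlog.eventually_ge_atTop (‖L‖ * (C + 2) - (R (h b) + c * Real.log (1 - b)))).and
      (Ioo_mem_nhdsLT hb1.2))
  refine not_intble_of_inv_le hd' (fun x hx => ?_) hv
  obtain ⟨hx1, hx2⟩ := hd'' x hx
  have hx0 : x ∈ Ioo (0 : ℝ) 1 := ⟨by linarith [hx.1, hd'.1], hx.2⟩
  have hxI : x ∈ Ioo (-1 : ℝ) 1 := ⟨by linarith [hx0.1], hx.2⟩
  have h6 := hmono hb1 ⟨hb1.1.trans hx2.1, hx.2⟩ hx2.1.le
  simp only at h6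
  have h7 : ‖L‖ * (C + 2) ≤ ‖L‖ * ‖h x‖ := by linarith [hR (h x)]
  have h8 : C + 2 ≤ ‖h x‖ := le_of_mul_le_mul_left h7 hL0
  have h9 : ‖h x‖ ≤ (1 - x ^ 2) * ‖v x‖ + C := by
    rw [hh x hxI]
    refine (norm_add_le _ _).trans (add_le_add ?_ (hr x hxI))
    rw [norm_mul, norm_weight hx0]
  have hpos : 0 < 1 - x := by linarith [hx.2]
  rw [inv_le_iff_one_le_mul₀ hpos]
  nlinarith [mul_nonneg (mul_nonneg hpos.le hpos.le) (norm_nonneg (v x))]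

/-- The weight is even, so the reflection `x ↦ -x` carries the results at `1` over to `-1`. -/
theorem tendsto_nhdsGT_neg_one_iff {F : ℝ → ℂ} {l : Filter ℂ} :
    Tendsto F (𝓝[>] (-1)) l ↔ Tendsto (fun x => F (-x)) (𝓝[<] 1) l := by
  refine ⟨fun h => h.comp tendsto_neg_nhdsLT, fun h => ?_⟩
  have : Tendsto Neg.neg (𝓝[>] (-1 : ℝ)) (𝓝[<] 1) := by
    simpa using tendsto_neg_nhdsGT (a := (-1 : ℝ))
  simpa [Function.comp_def] using h.comp this

theorem neg_mem_Ioo {x : ℝ} (hx : x ∈ Ioo (-1 : ℝ) 1) : -x ∈ Ioo (-1 : ℝ) 1 :=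
  ⟨by linarith [hx.2], by linarith [hx.1]⟩

theorem hasDerivAt_comp_neg {h h' : ℝ → ℂ} (hd : ∀ x ∈ Ioo (-1 : ℝ) 1, HasDerivAt h (h' x) x) :
    ∀ x ∈ Ioo (-1 : ℝ) 1, HasDerivAt (fun x => h (-x)) (-h' (-x)) x := by
  intro x hx
  simpa [Function.comp_def] using (hd (-x) (neg_mem_Ioo hx)).scomp x (hasDerivAt_neg x)

theorem tendsto_weight_mul_of_deriv_left {h h' : ℝ → ℂ}
    (hd : ∀ x ∈ Ioo (-1 : ℝ) 1, HasDerivAt h (h' x) x)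
    (hp : Tendsto (fun x : ℝ => (1 - (x : ℂ) ^ 2) * h' x) (𝓝[>] (-1)) (𝓝 0)) :
    Tendsto (fun x : ℝ => (1 - (x : ℂ) ^ 2) * h x) (𝓝[>] (-1)) (𝓝 0) := by
  rw [tendsto_nhdsGT_neg_one_iff] at hp ⊢
  have := tendsto_weight_mul_of_deriv (hasDerivAt_comp_neg hd) (by simpa using hp.neg)
  simpa using this

theorem Intble.comp_neg {v : ℝ → ℂ} (hv : Intble v) : Intble (fun x => v (-x)) := by
  unfold Intble at *
  rw [← integrable_indicator_iff measurableSet_Ioo] at hv ⊢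
  refine hv.comp_neg.congr (Eventually.of_forall fun x => ?_)
  simp only
  by_cases hx : x ∈ Ioo (-1 : ℝ) 1
  · rw [indicator_of_mem hx, indicator_of_mem (neg_mem_Ioo hx)]
  · rw [indicator_of_notMem hx, indicator_of_notMem
      (fun h => hx (by simpa using neg_mem_Ioo h))]

theorem eq_zero_of_tendsto_weight_mul_deriv_left {h h' v r : ℝ → ℂ} {L : ℂ}
    (hd : ∀ x ∈ Ioo (-1 : ℝ) 1, HasDerivAt h (h' x) x)
    (hp : Tendsto (fun x : ℝ => (1 - (x : ℂ) ^ 2) * h' x) (𝓝[>] (-1)) (𝓝 L))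
    (hv : Intble v) {C : ℝ} (hr : ∀ x ∈ Ioo (-1 : ℝ) 1, ‖r x‖ ≤ C)
    (hh : ∀ x ∈ Ioo (-1 : ℝ) 1, h x = (1 - (x : ℂ) ^ 2) * v x + r x) : L = 0 := by
  rw [tendsto_nhdsGT_neg_one_iff] at hp
  refine neg_eq_zero.1 (eq_zero_of_tendsto_weight_mul_deriv (hasDerivAt_comp_neg hd)
    (by simpa using hp.neg) hv.comp_neg (fun x hx => hr (-x) (neg_mem_Ioo hx)) fun x hx => ?_)
  simpa using hh (-x) (neg_mem_Ioo hx)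

theorem tendsto_weight_right : Tendsto (fun x : ℝ => 1 - (x : ℂ) ^ 2) (𝓝[<] 1) (𝓝 0) := by
  simpa using (contDiff_weight.continuous.tendsto 1).mono_left nhdsWithin_le_nhds

theorem tendsto_weight_left : Tendsto (fun x : ℝ => 1 - (x : ℂ) ^ 2) (𝓝[>] (-1)) (𝓝 0) := by
  simpa using (contDiff_weight.continuous.tendsto (-1)).mono_left nhdsWithin_le_nhds

theorem tendsto_weight_mul_of_bounded {u : ℝ → ℂ} {C : ℝ}
    (hu : ∀ x ∈ Ioo (-1 : ℝ) 1, ‖u x‖ ≤ C) :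
    Tendsto (fun x : ℝ => (1 - (x : ℂ) ^ 2) * u x) (𝓝[>] (-1)) (𝓝 0) ∧
    Tendsto (fun x : ℝ => (1 - (x : ℂ) ^ 2) * u x) (𝓝[<] 1) (𝓝 0) := by
  constructor
  · refine tendsto_weight_left.zero_mul_isBoundedUnder_le
      (isBoundedUnder_of_eventually_le (a := C) ?_)
    filter_upwards [Ioo_mem_nhdsGT (show (-1 : ℝ) < 1 by norm_num)] with x hx using hu x hx
  · refine tendsto_weight_right.zero_mul_isBoundedUnder_le
      (isBoundedUnder_of_eventually_le (a := C) ?_)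
    filter_upwards [Ioo_mem_nhdsLT (show (-1 : ℝ) < 1 by norm_num)] with x hx using hu x hx

/-- If `(1 - x²) h'` vanishes at both endpoints, then so do the brackets with smooth functions. -/
theorem tendsto_bracket {h g : ℝ → ℂ} (hd : ∀ x ∈ Ioo (-1 : ℝ) 1, DifferentiableAt ℝ h x)
    (hg : ContDiff ℝ ∞ g)
    (hp : Tendsto (fun x : ℝ => (1 - (x : ℂ) ^ 2) * deriv h x) (𝓝[>] (-1)) (𝓝 0) ∧
      Tendsto (fun x : ℝ => (1 - (x : ℂ) ^ 2) * deriv h x) (𝓝[<] 1) (𝓝 0)) :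
    Tendsto (bracket h g) (𝓝[>] (-1)) (𝓝 0) ∧ Tendsto (bracket h g) (𝓝[<] 1) (𝓝 0) := by
  have hd' : ∀ x ∈ Ioo (-1 : ℝ) 1, HasDerivAt h (deriv h x) x := fun x hx => (hd x hx).hasDerivAt
  have key : ∀ (l : Filter ℝ) (a : ℝ), l ≤ 𝓝 a →
      Tendsto (fun x : ℝ => (1 - (x : ℂ) ^ 2) * h x) l (𝓝 0) →
      Tendsto (fun x : ℝ => (1 - (x : ℂ) ^ 2) * deriv h x) l (𝓝 0) →
      Tendsto (bracket h g) l (𝓝 0) := by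
    intro l a hl h1 h2
    have g1 := (hg.continuous.tendsto a).mono_left hl
    have g2 := ((hg.continuous_deriv (by simp)).tendsto a).mono_left hl
    have := (h1.mul g2).sub (h2.mul g1)
    rw [zero_mul, zero_mul, sub_zero] at this
    refine this.congr fun x => ?_
    simp only [bracket]
    ring
  exact ⟨key _ _ nhdsWithin_le_nhds (tendsto_weight_mul_of_deriv_left hd' hp.1) hp.1,
    key _ _ nhdsWithin_le_nhds (tendsto_weight_mul_of_deriv hd' hp.2) hp.2⟩

/-! ### The brackets of the iterates -/

theorem intble_of_memLp_two {u : ℝ → ℂ} (hu : MemLp u 2 vol) : Intble u := by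
  have : IsFiniteMeasure vol := by unfold vol; infer_instance
  exact hu.integrable (by norm_num)

/-- If `h = ℓ[y]` with `y'` bounded and `y''` integrable, and `ℓ[h]` is integrable, then
`(1 - x²) h'` vanishes at both endpoints. -/
theorem tendsto_weight_mul_deriv_ell {y : ℝ → ℂ} (hy : Tower ContBdd Intble 2 y)
    (hh : Tower ACloc ACloc 1 (ell y)) (hi : Intble (ell (ell y))) :
    Tendsto (fun x : ℝ => (1 - (x : ℂ) ^ 2) * deriv (ell y) x) (𝓝[>] (-1)) (𝓝 0) ∧
      Tendsto (fun x : ℝ => (1 - (x : ℂ) ^ 2) * deriv (ell y) x) (𝓝[<] 1) (𝓝 0) := by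
  have hac : ACloc (fun x => (1 - (x : ℂ) ^ 2) * deriv (ell y) x) :=
    isSmoothModule_ACloc.mul contDiff_weight hh.2.2
  have hi' : IntegrableOn (deriv fun x : ℝ => (1 - (x : ℂ) ^ 2) * deriv (ell y) x)
      (Ioo (-1) 1) := by
    refine (Integrable.neg hi).congr (Eventually.of_forall fun x => ?_)
    simp [ell]
  obtain ⟨G, hG, hFG⟩ := hac.exists_continuous_eqOn hi'
  have hd : ∀ x ∈ Ioo (-1 : ℝ) 1, HasDerivAt (ell y) (deriv (ell y) x) x :=
    fun x hx => (hh.2.1 x hx).hasDerivAt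
  have hv : Intble (fun x => (-1 : ℂ) * deriv (deriv y) x) :=
    isSmoothModule_intble.mul contDiff_const hy.2.2.2.2
  have hr : ContBdd (fun x => (2 * (x : ℂ)) * deriv y x) :=
    isSmoothModule_contBdd.mul (contDiff_const.mul Complex.ofRealCLM.contDiff) hy.2.2.1
  obtain ⟨C, hC⟩ := hr.2
  -- Product rule: the part with `y''` carries the weight, and the part with `y'` is bounded.
  have he : ∀ x ∈ Ioo (-1 : ℝ) 1, ell y x =
      (1 - (x : ℂ) ^ 2) * ((-1 : ℂ) * deriv (deriv y) x) + (2 * (x : ℂ)) * deriv y x := by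
    intro x hx
    have h1 : HasDerivAt (fun t : ℝ => 1 - (t : ℂ) ^ 2) (-(2 * (x : ℂ))) x := by
      simpa using ((hasDerivAt_id x).ofReal_comp.pow 2).const_sub 1
    have h2 := (hy.2.2.2.1 x hx).hasDerivAt
    simp only [ell]
    rw [(h1.fun_mul h2).deriv]
    ring
  have tl : Tendsto (fun x : ℝ => (1 - (x : ℂ) ^ 2) * deriv (ell y) x)
      (𝓝[>] (-1)) (𝓝 (G (-1))) :=
    ((hG.tendsto _).mono_left nhdsWithin_le_nhds).congr'
      (hFG.symm.eventuallyEq_of_mem (Ioo_mem_nhdsGT (by norm_num)))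
  have tr : Tendsto (fun x : ℝ => (1 - (x : ℂ) ^ 2) * deriv (ell y) x) (𝓝[<] 1) (𝓝 (G 1)) :=
    ((hG.tendsto _).mono_left nhdsWithin_le_nhds).congr'
      (hFG.symm.eventuallyEq_of_mem (Ioo_mem_nhdsLT (by norm_num)))
  have zl := eq_zero_of_tendsto_weight_mul_deriv_left hd tl hv hC he
  have zr := eq_zero_of_tendsto_weight_mul_deriv hd tr hv hC he
  rw [zl] at tl
  rw [zr] at tr
  exact ⟨tl, tr⟩

theorem tower_ell_iterate {n : ℕ} {f : ℝ → ℂ} (hf : f ∈ maxDomain n) {k : ℕ} (hk : k < n) :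
    Tower ACloc ACloc 1 (ell^[k] f) := by
  have h := tower_ACloc_of_iteratedDeriv (M := 2 * n - 1) (fun j hj => hf.1 j (by omega)) _ le_rfl
  rw [Nat.sub_self, iteratedDeriv_zero] at h
  exact Tower.ell_iterate isSmoothModule_ACloc isSmoothModule_ACloc (fun _ h => h) k
    (h.mono (fun _ h => h) (by omega))

/-- Each `ℓ` costs two derivatives, so two remain after `k` steps exactly when `2k + 2 ≤ 2n - 2`. -/
theorem tower_contBdd_ell_iterate {n : ℕ} (hn : 2 ≤ n) {f : ℝ → ℂ} (hf : f ∈ maxDomain n)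
    (hL : f ∈ derivsInL2 n) {k : ℕ} (hk : k + 2 ≤ n) : Tower ContBdd Intble 2 (ell^[k] f) := by
  have h := tower_contBdd_of_iteratedDeriv (M := 2 * n - 2) (fun j hj => hf.1 j (by omega))
    (intble_of_memLp_two (hL _ (by omega) (by omega))) _ le_rfl
  rw [Nat.sub_self, iteratedDeriv_zero] at h
  exact Tower.ell_iterate isSmoothModule_contBdd isSmoothModule_intble (fun _ h => h.intble) k
    (h.mono (fun _ h => h.intble) (by omega))

theorem tendsto_weight_mul_deriv_iterate {n : ℕ} {f : ℝ → ℂ} (hf : f ∈ domF n)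
    (hL : f ∈ derivsInL2 n)
    (h1 : n = 1 → Tendsto (fun x : ℝ => (1 - (x : ℂ) ^ 2) * deriv f x) (𝓝[<] 1) (𝓝 0))
    {k : ℕ} (hk : k < n) :
    Tendsto (fun x : ℝ => (1 - (x : ℂ) ^ 2) * deriv (ell^[k] f) x) (𝓝[>] (-1)) (𝓝 0) ∧
      Tendsto (fun x : ℝ => (1 - (x : ℂ) ^ 2) * deriv (ell^[k] f) x) (𝓝[<] 1) (𝓝 0) := by
  rcases Nat.lt_or_ge n 2 with hn | hn
  · obtain rfl : n = 1 := by omega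
    obtain rfl : k = 0 := by omega
    obtain ⟨L, l1, l2⟩ := hf.2 1 le_rfl le_rfl
    simp only [coeff, legendreStirling, Nat.sub_self, iteratedDeriv_zero, iteratedDeriv_one,
      pow_one, mul_zero, add_zero, Nat.cast_one, one_mul] at l1 l2
    obtain rfl : L = 0 := tendsto_nhds_unique l2 (h1 rfl)
    exact ⟨l1, l2⟩
  · rcases Nat.lt_or_ge (k + 1) n with hk' | hk'
    · obtain ⟨C, hC⟩ := (tower_contBdd_ell_iterate hn hf.1 hL hk').2.2.1.2
      exact tendsto_weight_mul_of_bounded hC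
    · obtain ⟨m, rfl⟩ : ∃ m, n = m + 2 := ⟨n - 2, by omega⟩
      obtain rfl : k = m + 1 := by omega
      have hh := tower_ell_iterate hf.1 hk
      have hi := intble_of_memLp_two hf.1.2.2
      rw [ellPow, Function.iterate_succ_apply', Function.iterate_succ_apply'] at hi
      rw [Function.iterate_succ_apply'] at hh ⊢
      exact tendsto_weight_mul_deriv_ell (tower_contBdd_ell_iterate hn hf.1 hL le_rfl) hh hi

theorem contDiff_P (j : ℕ) : ContDiff ℝ ∞ (P j) :=
  Complex.ofRealCLM.contDiff.comp (by simpa using (legendrePoly j).contDiff_aeval (𝕜 := ℝ) ∞)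

theorem star_P (j : ℕ) (x : ℝ) : star (P j x) = P j x := Complex.conj_ofReal _

theorem formVanishes_P {n : ℕ} {f : ℝ → ℂ} (hf : f ∈ domF n) (hL : f ∈ derivsInL2 n)
    (h1 : n = 1 → Tendsto (fun x : ℝ => (1 - (x : ℂ) ^ 2) * deriv f x) (𝓝[<] 1) (𝓝 0))
    (j : ℕ) : FormVanishes n f (P j) := by
  have h := (tendsto_form_of_brackets (fun k hk => tower_ell_iterate hf.1 hk)
    (fun k hk g hg => tendsto_bracket (tower_ell_iterate hf.1 hk).2.1 hg
      (tendsto_weight_mul_deriv_iterate hf hL h1 hk)) (P j) (contDiff_P j)).2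
  simpa only [FormVanishes, form, ellPow, star_P] using h

end LegendrePowers

theorem mainTheorem6 (n : ℕ) (hn : 1 ≤ n) :
    (∀ f ∈ LegendrePowers.domF n, f ∈ LegendrePowers.derivsInL2 n →
      (n = 1 → Tendsto (fun x : ℝ => (1 - (x : ℂ) ^ 2) * deriv f x) (𝓝[<] 1) (𝓝 0)) →
      f ∈ LegendrePowers.domC n) ∧
    LegendrePowers.domC n ⊆ LegendrePowers.domB n := by
  refine ⟨fun f hf hL h1 => ⟨hf.1, fun S _ j _ => LegendrePowers.formVanishes_P hf hL h1 j⟩,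
    fun f hf => ⟨hf.1, fun j hj => ?_⟩⟩
  exact hf.2 (Finset.range n) (Finset.card_range n) j (Finset.mem_range.2 hj)
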